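/- Let $\mathcal H$ be a real Hilbert space. For $T:\mathcal H\to\mathcal H$ put $\mathrm{Fix}\,T=\{x: T(x)=x\}$ and, for $\lambda\in\mathbb R$, $T_\lambda=(1-\lambda)\mathrm{Id}+\lambda T$. $T$ is firmly nonexpansive if $\|T(x)-T(y)\|^2\le\langle T(x)-T(y),x-y\rangle$ for all $x,y$, and $\alpha$-relaxed firmly nonexpansive if $T=U_\alpha$ for some firmly nonexpansive $U$. **Setting.** Let $m\ge1$, $\alpha_1,\dots,\alpha_m\in(0,2]$, and let $U_i:\mathcal H\to\mathcal H$ be $\alpha_i$-relaxed firmly nonexpansive for $i=1,\dots,m$. Let $(q_k)_{k\ge0}$ be a bounded sequence of positive integers, let each $\Omega_k$ be a nonempty set of maps $t:\{1,\dots,q_k\}\to\{1,\dots,m\}$ and let $\omega_k:\Omega_k\to(0,1]$ satisfy $\sum_{t\in\Omega_k}\omega_k(t)=1$. Put $$T_k:=T_{(\Omega_k,\omega_k)}:=\sum_{t\in\Omega_k}\omega_k(t)\,U_{t(q_k)}\cdots U_{t(2)}U_{t(1)},\qquad \rho:=\min\Big\{\big(\max_k q_k\big)^{-1}\min_{1\le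 i\le m}\frac{2-\alpha_i}{\alpha_i},\,1\Big\}.$$ Let $I:=\bigcap_{n\ge0}\bigcup_{k\ge n}\{T_k\}$ and $C:=\bigcap_{T\in I}\mathrm{Fix}\,T$. The sequence $(T_k)$ is called $\limsup$-admissible if $T_k\in I$ for all $k$ and for every $T\in I$ there is an integer $M_T>0$ such that $T\in\{T_k,\dots,T_{k+M_T-1}\}$ for all $k\ge0$. A quasi-nonexpansive operator $T$ (that is, $\|T(x)-z\|\le\|x-z\|$ for all $x$ and all $z\in\mathrm{Fix}\,T$) is approximately shrinking if for every bounded sequence $(x^k)$, $\|T(x^k)-x^k\|\to0$ implies $d(x^k,\mathrm{Fix}\,T)\to0$. The family $\{\mathrm{Fix}\,T\}_{T\in I}$ is boundedly regular if for every bounded sequence $(x^k)$, $d(x^k,\mathrm{Fix}\,T)\to0$ for each $T\in I$ implies $d(x^k,C)\to0$. For operators $S_k:\mathcal H\to\mathcal H$ ($k\ge0$), the algorithm $x^{k+1}=S_k(x^k)$ is weakly (strongly) bounded perturbations resilient with respect to $C$ if the following holds: if for every $x^0\in\mathcal H$ the generated sequence converges weakly (strongly) to a point of $C$, then for all $\beta_k>0$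 with $\sum_k\beta_k<\infty$, every bounded sequence $(v^k)$ in $\mathcal H$ and every $y^0\in\mathcal H$, the sequence $y^{k+1}=S_k(y^k+\beta_kv^k)$ converges weakly (strongly) to a point of $C$. **Theorem.** Assume that $C\ne\emptyset$ and that $(T_k)$ is $\limsup$-admissible. Let $\varepsilon>0$, let $\lambda_k\in[\varepsilon,1+\rho-\varepsilon]$ for all $k$, let $x^0\in\mathcal H$ and $x^{k+1}=x^k+\lambda_k(T_k(x^k)-x^k)$ for all $k\ge0$. Then: (i) $(x^k)$ converges weakly to a point of $C$. (ii) $(x^k)$ is Fejér monotone with respect to $C$, i.e. $\|x^{k+1}-z\|\le\|x^k-z\|$ for all $z\in C$ and $k\ge0$; more precisely, $$\|x^{k+1}-z\|^2\le\|x^k-z\|^2-\varepsilon(1+\rho-\varepsilon)^{-1}\|x^{k+1}-x^k\|^2\qquad(z\in C,\ k\ge0),$$ and $\|x^{k+1}-x^k\|\to0$. (iii) If every $T\in I$ is approximately shrinking and $\{\mathrm{Fix}\,T\}_{T\in I}$ is boundedly regular, then $(x^k)$ converges strongly to a point of $C$. (iv) The algorithm $x^{k+1}=(T_k)_{\lambda_k}(x^k)$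 is weakly bounded perturbations resilient with respect to $C$. If the convergence of the algorithm is strong, in the sense that for every $n\ge0$ and every $z^0\in\mathcal H$ the sequence $z^{k+1}=z^k+\lambda_{n+k}(T_{n+k}(z^k)-z^k)$ converges strongly to a point of $C$, then the algorithm is strongly bounded perturbations resilient with respect to $C$. In particular, it is strongly bounded perturbations resilient under the assumptions of (iii). -/

import Mathlib

open Filter Topology

namespace GDSA

/-! ### Operators on a real Hilbert space -/

section Operators

variable {H : Type*} [NormedAddCommGroup H] [InnerProductSpace ℝ H]

/-- The `l`-relaxation `(1 - l) Id + l T` of an operator `T`. -/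
def relax (T : H → H) (l : ℝ) : H → H := fun x => (1 - l) • x + l • T x

/-- Firmly nonexpansive operators. -/
def FirmlyNonexpansive (T : H → H) : Prop :=
  ∀ x y : H, ‖T x - T y‖ ^ 2 ≤ inner ℝ (T x - T y) (x - y)

/-- `T` is `a`-relaxed firmly nonexpansive: it is the `a`-relaxation of a firmly nonexpansive
operator. -/
def RelaxedFirmlyNonexpansive (a : ℝ) (T : H → H) : Prop :=
  ∃ U : H → H, FirmlyNonexpansive U ∧ T = relax U a

/-- Quasi-nonexpansive operators (the fixed point set is not required to be nonempty). -/
def QuasiNonexpansive (T : H → H) : Prop :=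
  ∀ x : H, ∀ z ∈ Function.fixedPoints T, ‖T x - z‖ ≤ ‖x - z‖

/-- Approximately shrinking operators. -/
def ApproximatelyShrinking (T : H → H) : Prop :=
  QuasiNonexpansive T ∧
    ∀ x : ℕ → H, Bornology.IsBounded (Set.range x) →
      Tendsto (fun k => ‖T (x k) - x k‖) atTop (𝓝 0) →
      Tendsto (fun k => Metric.infDist (x k) (Function.fixedPoints T)) atTop (𝓝 0)

/-- Bounded regularity of a family of sets. (It is used for nonempty families of nonempty closed
convex sets with nonempty intersection.) -/
def BoundedlyRegular {ι : Type*} (S : ι → Set H) : Prop :=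
  ∀ x : ℕ → H, Bornology.IsBounded (Set.range x) →
    (∀ i, Tendsto (fun k => Metric.infDist (x k) (S i)) atTop (𝓝 0)) →
    Tendsto (fun k => Metric.infDist (x k) (⋂ i, S i)) atTop (𝓝 0)

/-- Weak convergence of a sequence to a point: convergence in the weak topology. -/
def WeakTendsto (x : ℕ → H) (p : H) : Prop :=
  Tendsto (fun k => toWeakSpace ℝ H (x k)) atTop (𝓝 (toWeakSpace ℝ H p))

/-- Weak convergence of a sequence to some point of `C`. -/
def ConvergesWeaklyIn (x : ℕ → H) (C : Set H) : Prop := ∃ p ∈ C, WeakTendsto x p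

/-- Strong (norm) convergence of a sequence to some point of `C`. -/
def ConvergesStronglyIn (x : ℕ → H) (C : Set H) : Prop := ∃ p ∈ C, Tendsto x atTop (𝓝 p)

/-- Fejér monotonicity of a sequence with respect to `C`. -/
def FejerMonotone (x : ℕ → H) (C : Set H) : Prop :=
  ∀ z ∈ C, ∀ k : ℕ, ‖x (k + 1) - z‖ ≤ ‖x k - z‖

end Operators

/-! ### Bounded perturbations resilience -/

section Resilience

variable {H : Type*} [NormedAddCommGroup H] [InnerProductSpace ℝ H]

/-- `x` is generated by the algorithm `x (k+1) = S k (x k)` (with an arbitrary starting point). -/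
def GeneratedBy (S : ℕ → H → H) (x : ℕ → H) : Prop := ∀ k : ℕ, x (k + 1) = S k (x k)

/-- `y` is generated by `y (k+1) = S k (y k + b k • v k)`, where `b` is a summable sequence of
positive numbers and `v` is a bounded sequence. -/
def PerturbedBy (S : ℕ → H → H) (b : ℕ → ℝ) (v : ℕ → H) (y : ℕ → H) : Prop :=
  (∀ k, 0 < b k) ∧ Summable b ∧ Bornology.IsBounded (Set.range v) ∧
    ∀ k : ℕ, y (k + 1) = S k (y k + b k • v k)

/-- The algorithm `x (k+1) = S k (x k)` is weakly bounded perturbations resilient with respect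
to `C`. -/
def WeaklyResilient (S : ℕ → H → H) (C : Set H) : Prop :=
  (∀ x : ℕ → H, GeneratedBy S x → ConvergesWeaklyIn x C) →
    ∀ (b : ℕ → ℝ) (v y : ℕ → H), PerturbedBy S b v y → ConvergesWeaklyIn y C

/-- The algorithm `x (k+1) = S k (x k)` is strongly bounded perturbations resilient with respect
to `C`. -/
def StronglyResilient (S : ℕ → H → H) (C : Set H) : Prop :=
  (∀ x : ℕ → H, GeneratedBy S x → ConvergesStronglyIn x C) →
    ∀ (b : ℕ → ℝ) (v y : ℕ → H), PerturbedBy S b v y → ConvergesStronglyIn y C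

end Resilience

/-! ### String averaging -/

section StringAveraging

variable {H : Type*} [NormedAddCommGroup H] [InnerProductSpace ℝ H] {m : ℕ}

/-- The string operator of a string `t` of length `q`: `U (t 0)` is applied first and
`U (t (q - 1))` last. -/
def stringOp (U : Fin m → H → H) {q : ℕ} (t : Fin q → Fin m) : H → H :=
  fun x => (List.ofFn t).foldl (fun y i => U i y) x

/-- The string-averaging operator of a finite set `Om` of strings with weights `w`. -/
def stringAvg (U : Fin m → H → H) {q : ℕ} (Om : Finset (Fin q → Fin m))
    (w : (Fin q → Fin m) → ℝ) : H → H :=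
  fun x => ∑ t ∈ Om, w t • stringOp U t x

/-- `min {M⁻¹ * min_i (2 - a i) / a i, 1}`, where `M` is the largest string length. -/
noncomputable def rho (a : Fin m → ℝ) (q : ℕ → ℕ) : ℝ :=
  min (((⨆ k, q k : ℕ) : ℝ)⁻¹ * ⨅ i, (2 - a i) / a i) 1

/-- The set of operators that occur infinitely often in the sequence `T`: the upper limit of the
sequence of singletons `{T k}`. -/
def opLimsup (T : ℕ → H → H) : Set (H → H) :=
  limsup (fun k => ({T k} : Set (H → H))) atTop

/-- `limsup`-admissible sequences of operators. -/
def LimsupAdmissible (T : ℕ → H → H) : Prop :=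
  (∀ k, T k ∈ opLimsup T) ∧
    ∀ S ∈ opLimsup T, ∃ M : ℕ, 0 < M ∧ ∀ k : ℕ, ∃ n ∈ Set.Ico k (k + M), S = T n

/-- The set of common fixed points of the operators of `opLimsup T`. -/
def target (T : ℕ → H → H) : Set H := ⋂ S ∈ opLimsup T, Function.fixedPoints S

/-- `x` is generated by the relaxed iteration `x (k+1) = x k + l k • (T k (x k) - x k)`. -/
def Iterates (T : ℕ → H → H) (l : ℕ → ℝ) (x : ℕ → H) : Prop :=
  ∀ k : ℕ, x (k + 1) = x k + l k • (T k (x k) - x k)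

end StringAveraging

end GDSA

/-! Everything rests on the averagedness inequality `AveragedWith`. It holds for each `U i` with
constant `(2 - a i) / a i`, survives a string of length `q` at the cost of a factor `q`
(`exists_foldl_averaged`), and is preserved by convex combinations (`averagedWith_sum`); so all `T
k` share the constant `rho`. Relaxation then yields the Fejér estimate with its decrement, and the
steps tend to zero. Because every operator recurs with bounded gaps, small steps make the residual
of each fixed `T j` small along the whole sequence (`Iterates.tendsto_residual`). Demiclosedness and
Opial's lemma give weak convergence; approximate shrinking and bounded regularity force the distance
to the target to zero, which for Fejér sequences gives strong convergence. For resilience, restart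
the unperturbed algorithm at each `y n`. Nonexpansiveness keeps this orbit within the tail sum of
the perturbations from `y`. The limits of these orbits form a Cauchy sequence, whose limit is the
limit of `y`. -/

namespace GDSA

/-! ### Averaged operators -/

section Averaged

variable {H : Type*} [NormedAddCommGroup H] [InnerProductSpace ℝ H]

/-- `‖T x - T y‖² + r ‖(x - y) - (T x - T y)‖² ≤ ‖x - y‖²` for all `x` and `y`: for `r ≥ 0`, these
are the averaged operators with averaging constant `(1 + r)⁻¹`. -/
def AveragedWith (r : ℝ) (T : H → H) : Prop :=
  ∀ x y : H, ‖T x - T y‖ ^ 2 + r * ‖(x - y) - (T x - T y)‖ ^ 2 ≤ ‖x - y‖ ^ 2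

lemma FirmlyNonexpansive.averagedWith_one {T : H → H} (hT : FirmlyNonexpansive T) :
    AveragedWith 1 T := by
  intro x y
  have h := hT x y
  rw [norm_sub_sq_real (x - y), real_inner_comm]
  linarith

lemma AveragedWith.mono {E : Type*} [NormedAddCommGroup E] {r s : ℝ} {T : E → E}
    (hT : AveragedWith r T) (hsr : s ≤ r) :
    AveragedWith s T := fun x y =>
  (by gcongr : _ ≤ ‖T x - T y‖ ^ 2 + r * ‖(x - y) - (T x - T y)‖ ^ 2).trans (hT x y)

/-- With `a = x - y` and `b = T x - T y`, averagedness is equivalent to `(1 + r) ‖a - b‖² ≤ 2 ⟪a, a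
- b⟫`; inserting this into the expansion of `‖a - l (a - b)‖²` gives the new constant. -/
lemma AveragedWith.relax {r l : ℝ} {T : H → H} (hT : AveragedWith r T) (hl : 0 < l) :
    AveragedWith ((1 + r - l) / l) (relax T l) := by
  intro x y
  have h := hT x y
  set a := x - y with ha
  set b := T x - T y with hb
  have h1 : GDSA.relax T l x - GDSA.relax T l y = a - l • (a - b) := by
    simp only [GDSA.relax, ha, hb]; module
  have h2 : a - (a - l • (a - b)) = l • (a - b) := by module
  have h3 : ‖b‖ ^ 2 = ‖a‖ ^ 2 - 2 * inner ℝ a (a - b) + ‖a - b‖ ^ 2 := by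
    rw [← norm_sub_sq_real, sub_sub_cancel]
  have h4 : (1 + r - l) / l * (l ^ 2 * ‖a - b‖ ^ 2) = l * ((1 + r - l) * ‖a - b‖ ^ 2) := by
    field_simp
  rw [h1, h2, norm_sub_sq_real, inner_smul_right, norm_smul, mul_pow, Real.norm_eq_abs, sq_abs, h4]
  nlinarith [mul_le_mul_of_nonneg_left h hl.le]

lemma RelaxedFirmlyNonexpansive.averagedWith {a : ℝ} {T : H → H} (ha : 0 < a)
    (hT : RelaxedFirmlyNonexpansive a T) : AveragedWith ((2 - a) / a) T := by
  obtain ⟨U, hU, rfl⟩ := hT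
  have h := hU.averagedWith_one.relax ha
  rwa [one_add_one_eq_two] at h

lemma AveragedWith.nonexpansive {E : Type*} [NormedAddCommGroup E] {r : ℝ} {T : E → E}
    (hT : AveragedWith r T) (hr : 0 ≤ r) (x y : E) :
    ‖T x - T y‖ ≤ ‖x - y‖ := by
  have h := hT x y
  have : 0 ≤ r * ‖(x - y) - (T x - T y)‖ ^ 2 := by positivity
  exact le_of_sq_le_sq (by linarith) (norm_nonneg _)

/-- A product of `n` averaged operators: the displacement loses a factor `n`. -/
lemma exists_foldl_averaged {E : Type*} [NormedAddCommGroup E] {ι : Type*} {μ : ℝ} {U : ι → E → E}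
    (hU : ∀ i, AveragedWith μ (U i)) (L : List ι) (x y : E) :
    ∃ W : ℝ, 0 ≤ W ∧
      ‖L.foldl (fun z i => U i z) x - L.foldl (fun z i => U i z) y‖ ^ 2 + μ * W ≤ ‖x - y‖ ^ 2 ∧
      ‖(x - y) - (L.foldl (fun z i => U i z) x - L.foldl (fun z i => U i z) y)‖ ^ 2
        ≤ L.length * W := by
  induction L generalizing x y with
  | nil => exact ⟨0, le_rfl, by simp, by simp⟩
  | cons i L ih =>
    obtain ⟨W, hW, h1, h2⟩ := ih (U i x) (U i y)
    have h3 := hU i x y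
    simp only [List.foldl_cons, List.length_cons]
    set c := L.foldl (fun z i => U i z) (U i x) - L.foldl (fun z i => U i z) (U i y)
    set b := U i x - U i y
    set a := x - y
    refine ⟨‖a - b‖ ^ 2 + W, by positivity, by linarith, ?_⟩
    have h4 : ‖a - c‖ ≤ ‖a - b‖ + ‖b - c‖ := norm_sub_le_norm_sub_add_norm_sub a b c
    have h5 : ‖a - c‖ ^ 2 ≤ (‖a - b‖ + ‖b - c‖) ^ 2 := by gcongr
    -- The cross term, by AM-GM: its square is at most `4 (n ‖a - b‖²) W` with `n = L.length`. This
    -- is what turns the factor `n` into `n + 1`.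
    have h6 : 2 * (‖a - b‖ * ‖b - c‖) ≤ L.length * ‖a - b‖ ^ 2 + W := by
      refine le_of_sq_le_sq ?_ (by positivity)
      have := mul_le_mul_of_nonneg_left h2 (sq_nonneg ‖a - b‖)
      nlinarith [sq_nonneg (L.length * ‖a - b‖ ^ 2 - W)]
    push_cast
    linarith

lemma averagedWith_stringOp {E : Type*} [NormedAddCommGroup E] {m : ℕ} {μ : ℝ} (hμ : 0 ≤ μ)
    {U : Fin m → E → E}
    (hU : ∀ i, AveragedWith μ (U i)) {q : ℕ} (hq : 0 < q) (t : Fin q → Fin m) :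
    AveragedWith ((q : ℝ)⁻¹ * μ) (stringOp U t) := by
  intro x y
  obtain ⟨W, -, h1, h2⟩ := exists_foldl_averaged hU (List.ofFn t) x y
  rw [List.length_ofFn] at h2
  refine le_trans ?_ h1
  have hq' : (0 : ℝ) < q := by exact_mod_cast hq
  have h3 : (q : ℝ)⁻¹ * μ * (q * W) = μ * W := by field_simp
  rw [← h3]
  unfold stringOp
  gcongr

lemma norm_sum_smul_sq_le {ι : Type*} {s : Finset ι} {w : ι → ℝ} (hw : ∀ i ∈ s, 0 ≤ w i)
    (hw1 : ∑ i ∈ s, w i = 1) (f : ι → H) :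
    ‖∑ i ∈ s, w i • f i‖ ^ 2 ≤ ∑ i ∈ s, w i * ‖f i‖ ^ 2 := by
  have h : ConvexOn ℝ Set.univ (fun x : H => ‖x‖ ^ 2) :=
    convexOn_univ_norm.pow (fun _ _ => norm_nonneg _) 2
  simpa using h.map_sum_le hw hw1 (p := f) (fun _ _ => Set.mem_univ _)

/-- Both squared norms on the left are convex, so Jensen applies to each; `hr` keeps the second one
in the right direction. -/
lemma averagedWith_sum {ι : Type*} {r : ℝ} (hr : 0 ≤ r) {s : Finset ι} {w : ι → ℝ}
    (hw : ∀ i ∈ s, 0 ≤ w i) (hw1 : ∑ i ∈ s, w i = 1) {T : ι → H → H}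
    (hT : ∀ i, AveragedWith r (T i)) : AveragedWith r (fun x => ∑ i ∈ s, w i • T i x) := by
  intro x y
  have h1 : ∑ i ∈ s, w i • T i x - ∑ i ∈ s, w i • T i y = ∑ i ∈ s, w i • (T i x - T i y) := by
    simp only [smul_sub, Finset.sum_sub_distrib]
  have h2 : (x - y) - ∑ i ∈ s, w i • (T i x - T i y)
      = ∑ i ∈ s, w i • ((x - y) - (T i x - T i y)) := by
    simp only [smul_sub _ (x - y), Finset.sum_sub_distrib, ← Finset.sum_smul, hw1, one_smul]
  simp only [h1, h2]
  calc _ ≤ ∑ i ∈ s, w i * ‖T i x - T i y‖ ^ 2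
        + r * ∑ i ∈ s, w i * ‖(x - y) - (T i x - T i y)‖ ^ 2 := by
        gcongr <;> exact norm_sum_smul_sq_le hw hw1 _
    _ = ∑ i ∈ s, w i * (‖T i x - T i y‖ ^ 2 + r * ‖(x - y) - (T i x - T i y)‖ ^ 2) := by
        simp only [mul_add, Finset.sum_add_distrib, Finset.mul_sum]
        congr 1
        exact Finset.sum_congr rfl fun i _ => by ring
    _ ≤ ∑ i ∈ s, w i * ‖x - y‖ ^ 2 :=
        Finset.sum_le_sum fun i hi => mul_le_mul_of_nonneg_left (hT i x y) (hw i hi)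
    _ = ‖x - y‖ ^ 2 := by rw [← Finset.sum_mul, hw1, one_mul]

lemma rho_nonneg {m : ℕ} {a : Fin m → ℝ} (ha : ∀ i, a i ∈ Set.Ioc (0 : ℝ) 2) (q : ℕ → ℕ) :
    0 ≤ rho a q :=
  le_min (mul_nonneg (by positivity)
    (Real.iInf_nonneg fun i => div_nonneg (by linarith [(ha i).2]) (ha i).1.le)) zero_le_one

lemma averagedWith_stringAvg {m : ℕ} {U : Fin m → H → H} {a : Fin m → ℝ}
    (ha : ∀ i, a i ∈ Set.Ioc (0 : ℝ) 2) (hU : ∀ i, RelaxedFirmlyNonexpansive (a i) (U i))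
    {q : ℕ → ℕ} (hqb : BddAbove (Set.range q)) {k : ℕ} (hq : 0 < q k)
    {Om : Finset (Fin (q k) → Fin m)} {w : (Fin (q k) → Fin m) → ℝ}
    (hw : ∀ t ∈ Om, 0 ≤ w t) (hw1 : ∑ t ∈ Om, w t = 1) :
    AveragedWith (rho a q) (stringAvg U Om w) := by
  have h0 : 0 ≤ ⨅ i, (2 - a i) / a i :=
    Real.iInf_nonneg fun i => div_nonneg (by linarith [(ha i).2]) (ha i).1.le
  have h1 : ∀ i, AveragedWith (⨅ i, (2 - a i) / a i) (U i) := fun i =>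
    ((hU i).averagedWith (ha i).1).mono (ciInf_le (Set.finite_range _).bddBelow i)
  refine averagedWith_sum (rho_nonneg ha q) hw hw1 fun t =>
    (averagedWith_stringOp h0 h1 hq t).mono ?_
  refine (min_le_left _ _).trans ?_
  have : ((q k : ℕ) : ℝ) ≤ ((⨆ k, q k : ℕ) : ℝ) := by exact_mod_cast le_ciSup hqb k
  have : (0 : ℝ) < q k := by exact_mod_cast hq
  gcongr

end Averaged

/-! ### Weak convergence and Fejér monotone sequences -/

section Weak

variable {H : Type*} [NormedAddCommGroup H] [InnerProductSpace ℝ H]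

lemma WeakTendsto.inner {x : ℕ → H} {p : H} (h : WeakTendsto x p) (u : H) :
    Tendsto (fun k => inner ℝ u (x k)) atTop (𝓝 (inner ℝ u p)) :=
  ((WeakBilin.eval_continuous _ (innerSL ℝ u)).tendsto _).comp h

/-- By the Riesz representation, inner products exhaust the continuous functionals. -/
lemma weakTendsto_iff_inner [CompleteSpace H] {x : ℕ → H} {p : H} :
    WeakTendsto x p ↔ ∀ u : H, Tendsto (fun k => inner ℝ u (x k)) atTop (𝓝 (inner ℝ u p)) := by
  refine ⟨WeakTendsto.inner, fun h => ?_⟩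
  refine (WeakBilin.tendsto_iff_forall_eval_tendsto (topDualPairing ℝ H).flip
    (fun f g hfg => ?_)).2 fun f => ?_
  · have h0 : inner ℝ (f - g) f = inner ℝ (f - g) g :=
      DFunLike.congr_fun hfg (innerSL ℝ (f - g))
    rwa [← sub_eq_zero, ← inner_sub_right, inner_self_eq_zero, sub_eq_zero] at h0
  · have := h ((InnerProductSpace.toDual ℝ H).symm f)
    simp only [InnerProductSpace.toDual_symm_apply] at this
    exact this

/-- Banach–Alaoglu, transported through the Riesz isometry. Ultrafilters take the place of weakly
convergent subsequences. -/
lemma exists_ultrafilter_weak_limit [CompleteSpace H] {ι : Type*} (F : Ultrafilter ι) {x : ι → H}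
    {R : ℝ} (hR : ∀ k, ‖x k‖ ≤ R) :
    ∃ p : H, ∀ u : H, Tendsto (fun k => inner ℝ u (x k)) F (𝓝 (inner ℝ u p)) := by
  let f : ι → WeakDual ℝ H := fun k => StrongDual.toWeakDual (InnerProductSpace.toDual ℝ H (x k))
  obtain ⟨g, -, hg⟩ := isCompact_iff_ultrafilter_le_nhds.1
    (WeakDual.isCompact_closedBall (0 : StrongDual ℝ H) R) (F.map f) (by
      refine le_principal_iff.2 (Eventually.of_forall (f := (F : Filter ι)) fun k => ?_)
      simpa [f] using hR k)
  refine ⟨(InnerProductSpace.toDual ℝ H).symm (WeakDual.toStrongDual g), fun u => ?_⟩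
  have h := ((WeakDual.eval_continuous u).tendsto g).comp (show Tendsto f F (𝓝 g) from hg)
  rw [real_inner_comm, InnerProductSpace.toDual_symm_apply]
  refine h.congr fun k => ?_
  rw [real_inner_comm]
  rfl

/-- The demiclosedness principle. -/
lemma fixed_of_weak_limit {ι : Type*} {F : Filter ι} [F.NeBot] {S : H → H}
    (hS : ∀ x y, ‖S x - S y‖ ≤ ‖x - y‖) {x : ι → H} {p : H} {R : ℝ} (hR : ∀ k, ‖x k - p‖ ≤ R)
    (hx : ∀ u : H, Tendsto (fun k => inner ℝ u (x k)) F (𝓝 (inner ℝ u p)))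
    (h0 : Tendsto (fun k => ‖S (x k) - x k‖) F (𝓝 0)) : S p = p := by
  have hlim : Tendsto (fun k => ‖S (x k) - x k‖ ^ 2 + 2 * ‖S (x k) - x k‖ * R
      - 2 * (inner ℝ (p - S p) (x k) - inner ℝ (p - S p) p)) F (𝓝 0) := by
    simpa using (((h0.pow 2).add ((h0.const_mul 2).mul_const R)).sub
      (((hx (p - S p)).sub_const (inner ℝ (p - S p) p)).const_mul 2))
  -- Compare the expansion of `‖x k - S p‖²` around `p` with its bound by `(‖S (x k) - x k‖ + ‖x k -
  -- p‖)²`: the terms `‖x k - p‖²` cancel, and what remains tends to zero.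
  have hle : ‖p - S p‖ ^ 2 ≤ 0 := by
    refine ge_of_tendsto' hlim fun k => ?_
    have h1 : ‖x k - S p‖ ≤ ‖S (x k) - x k‖ + ‖x k - p‖ := by
      calc ‖x k - S p‖ ≤ ‖x k - S (x k)‖ + ‖S (x k) - S p‖ :=
            norm_sub_le_norm_sub_add_norm_sub _ _ _
        _ ≤ _ := by rw [norm_sub_rev]; gcongr; exact hS _ _
    have h2 : ‖x k - S p‖ ^ 2 ≤ (‖S (x k) - x k‖ + ‖x k - p‖) ^ 2 := by gcongr
    have h3 : ‖x k - S p‖ ^ 2 = ‖p - S p‖ ^ 2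
        + 2 * (inner ℝ (p - S p) (x k) - inner ℝ (p - S p) p) + ‖x k - p‖ ^ 2 := by
      rw [← inner_sub_right, ← norm_add_sq_real]
      congr 2
      abel
    have h4 := mul_le_mul_of_nonneg_left (hR k) (norm_nonneg (S (x k) - x k))
    nlinarith
  have h5 : ‖p - S p‖ = 0 := by nlinarith [norm_nonneg (p - S p)]
  exact (sub_eq_zero.1 (norm_eq_zero.1 h5)).symm

lemma FejerMonotone.antitone {E : Type*} [NormedAddCommGroup E] {x : ℕ → E} {C : Set E}
    (hx : FejerMonotone x C) {z : E}
    (hz : z ∈ C) : Antitone fun k => ‖x k - z‖ :=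
  antitone_nat_of_succ_le fun k => hx z hz k

lemma FejerMonotone.exists_tendsto {E : Type*} [NormedAddCommGroup E] {x : ℕ → E} {C : Set E}
    (hx : FejerMonotone x C) {z : E}
    (hz : z ∈ C) : ∃ a, Tendsto (fun k => ‖x k - z‖) atTop (𝓝 a) :=
  ⟨_, tendsto_atTop_ciInf (hx.antitone hz) ⟨0, by rintro _ ⟨k, rfl⟩; exact norm_nonneg _⟩⟩

lemma FejerMonotone.norm_le {E : Type*} [NormedAddCommGroup E] {x : ℕ → E} {C : Set E}
    (hx : FejerMonotone x C) {z : E}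
    (hz : z ∈ C) (k : ℕ) : ‖x k‖ ≤ ‖x 0 - z‖ + ‖z‖ := by
  have h1 := hx.antitone hz (Nat.zero_le k)
  have h2 : ‖x k‖ ≤ ‖x k - z‖ + ‖z‖ := by simpa using norm_add_le (x k - z) z
  exact h2.trans (by gcongr)

/-- Opial's lemma: a Fejér monotone sequence whose weak cluster points lie in `C` converges weakly
to a point of `C`. -/
lemma FejerMonotone.convergesWeaklyIn [CompleteSpace H] {x : ℕ → H} {C : Set H}
    (hx : FejerMonotone x C) (hC : C.Nonempty)
    (hcl : ∀ (F : Ultrafilter ℕ) (p : H), (F : Filter ℕ) ≤ atTop →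
      (∀ u : H, Tendsto (fun k => inner ℝ u (x k)) F (𝓝 (inner ℝ u p))) → p ∈ C) :
    ConvergesWeaklyIn x C := by
  obtain ⟨z, hz⟩ := hC
  have hbd := hx.norm_le hz
  obtain ⟨p, hp⟩ := exists_ultrafilter_weak_limit (Ultrafilter.of (atTop : Filter ℕ)) hbd
  have hpC := hcl _ p (Ultrafilter.of_le _) hp
  refine ⟨p, hpC, weakTendsto_iff_inner.2 fun u => ?_⟩
  refine (tendsto_iff_ultrafilter _ _ _).2 fun F hF => ?_
  obtain ⟨p', hp'⟩ := exists_ultrafilter_weak_limit F hbd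
  have hpC' := hcl _ p' hF hp'
  obtain ⟨a, ha⟩ := hx.exists_tendsto hpC
  obtain ⟨a', ha'⟩ := hx.exists_tendsto hpC'
  -- `‖x k - p'‖² - ‖x k - p‖²` is an affine function of this inner product, so it converges along
  -- the full sequence and takes the same limit along both ultrafilters.
  have hconv : Tendsto (fun k => inner ℝ (p - p') (x k)) atTop
      (𝓝 ((a' ^ 2 - a ^ 2 - (‖p'‖ ^ 2 - ‖p‖ ^ 2)) / 2)) := by
    refine ((((ha'.pow 2).sub (ha.pow 2)).sub_const _).div_const 2).congr fun k => ?_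
    rw [norm_sub_sq_real, norm_sub_sq_real, inner_sub_left, real_inner_comm (x k) p,
      real_inner_comm (x k) p']
    ring
  have h1 := tendsto_nhds_unique (hconv.mono_left (Ultrafilter.of_le _)) (hp (p - p'))
  have h2 := tendsto_nhds_unique (hconv.mono_left hF) (hp' (p - p'))
  have h3 : inner ℝ (p - p') (p - p') = (0 : ℝ) := by
    rw [inner_sub_right, ← h1, ← h2, sub_self]
  rw [inner_self_eq_zero, sub_eq_zero] at h3
  rw [h3]
  exact hp' u

/-- Once some `x N` is within `e / 2` of a point of `C`, Fejér monotonicity keeps the whole tail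
that close to the same point, so the sequence is Cauchy. -/
lemma FejerMonotone.convergesStronglyIn {E : Type*} [NormedAddCommGroup E] [CompleteSpace E]
    {x : ℕ → E} {C : Set E}
    (hx : FejerMonotone x C) (hC : C.Nonempty) (hcl : IsClosed C)
    (h0 : Tendsto (fun k => Metric.infDist (x k) C) atTop (𝓝 0)) : ConvergesStronglyIn x C := by
  have hcau : CauchySeq x := by
    refine Metric.cauchySeq_iff'.2 fun e he => ?_
    obtain ⟨N, hN⟩ := (h0.eventually (gt_mem_nhds (half_pos he))).exists
    obtain ⟨z, hz, hdz⟩ := (Metric.infDist_lt_iff hC).1 hN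
    refine ⟨N, fun n hn => ?_⟩
    have h1 : dist (x n) z ≤ dist (x N) z := by
      simpa only [dist_eq_norm] using hx.antitone hz hn
    linarith [dist_triangle_right (x n) (x N) z]
  obtain ⟨p, hp⟩ := cauchySeq_tendsto_of_complete hcau
  refine ⟨p, ?_, hp⟩
  rw [hcl.mem_iff_infDist_zero hC]
  exact tendsto_nhds_unique (((Metric.continuous_infDist_pt C).tendsto p).comp hp) h0

end Weak

/-! ### The relaxed iteration -/

section Iteration

variable {H : Type*} [NormedAddCommGroup H] [InnerProductSpace ℝ H]

lemma mem_target_iff {X : Type*} {T : ℕ → X → X} (hT : LimsupAdmissible T) {z : X} :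
    z ∈ target T ↔ ∀ k, T k z = z := by
  simp only [target, Set.mem_iInter]
  refine ⟨fun h k => h _ (hT.1 k), fun h S hS => ?_⟩
  obtain ⟨M, -, hM⟩ := hT.2 S hS
  obtain ⟨n, -, rfl⟩ := hM 0
  exact h n

/-- The common fixed points of a sequence of operators. -/
def commonFix (T : ℕ → H → H) : Set H := {z | ∀ k, T k z = z}

lemma target_eq_commonFix {X : Type*} {T : ℕ → X → X} (hT : LimsupAdmissible T)
    : target T = commonFix T :=
  Set.ext fun _ => mem_target_iff hT

/-- Every operator of the sequence recurs with bounded gaps. -/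
def Recurrent (T : ℕ → H → H) : Prop :=
  ∀ j, ∃ M : ℕ, ∀ k, ∃ n, k ≤ n ∧ n ≤ k + M ∧ T n = T j

lemma LimsupAdmissible.recurrent {X : Type*} {T : ℕ → X → X} (hT : LimsupAdmissible T)
    : Recurrent T := by
  intro j
  obtain ⟨M, -, hM⟩ := hT.2 _ (hT.1 j)
  refine ⟨M, fun k => ?_⟩
  obtain ⟨n, hn, h⟩ := hM k
  exact ⟨n, hn.1, hn.2.le, h.symm⟩

lemma Recurrent.shift {X : Type*} {T : ℕ → X → X} (hT : Recurrent T) (n : ℕ) :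
    Recurrent fun k => T (n + k) := by
  intro j
  obtain ⟨M, hM⟩ := hT (n + j)
  refine ⟨M, fun k => ?_⟩
  obtain ⟨i, h1, h2, h3⟩ := hM (n + k)
  refine ⟨i - n, by omega, by omega, ?_⟩
  rwa [← Nat.add_sub_cancel' (show n ≤ i by omega)] at h3

/-- Every operator reappears after time `n`, so dropping a prefix loses no constraint. Thus results
for tails of the algorithm concern the same target. -/
lemma Recurrent.commonFix_shift {X : Type*} {T : ℕ → X → X} (hT : Recurrent T) (n : ℕ) :
    commonFix (fun k => T (n + k)) = commonFix T := by
  refine Set.Subset.antisymm (fun z hz k => ?_) fun z hz k => hz _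
  obtain ⟨M, hM⟩ := hT k
  obtain ⟨i, h1, -, h3⟩ := hM n
  rw [← h3, ← Nat.add_sub_cancel' h1]
  exact hz _

lemma isClosed_commonFix {E : Type*} [NormedAddCommGroup E] {T : ℕ → E → E}
    (hT : ∀ k, Continuous (T k)) :
    IsClosed (commonFix T) := by
  simp only [commonFix, Set.ofPred_forall]
  exact isClosed_iInter fun k => isClosed_eq (hT k) continuous_id

lemma iterates_iff_generatedBy {T : ℕ → H → H} {l : ℕ → ℝ} {x : ℕ → H} :
    Iterates T l x ↔ GeneratedBy (fun k => relax (T k) (l k)) x := by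
  refine forall_congr' fun k => ?_
  rw [show x k + l k • (T k (x k) - x k) = relax (T k) (l k) (x k) by unfold relax; module]

variable {T : ℕ → H → H} {l : ℕ → ℝ} {r e : ℝ} {x : ℕ → H}

lemma Iterates.sq_le (hT : ∀ k, AveragedWith r (T k)) (he : 0 < e)
    (hl : ∀ k, l k ∈ Set.Icc e (1 + r - e)) (hx : Iterates T l x) {z : H} (hz : z ∈ commonFix T)
    (k : ℕ) : ‖x (k + 1) - z‖ ^ 2 ≤
      ‖x k - z‖ ^ 2 - e * (1 + r - e)⁻¹ * ‖x (k + 1) - x k‖ ^ 2 := by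
  obtain ⟨h1, h2⟩ := hl k
  have hpos : 0 < l k := he.trans_le h1
  have h := (hT k).relax hpos (x k) z
  have h4 : x (k + 1) = relax (T k) (l k) (x k) := iterates_iff_generatedBy.1 hx k
  rw [← h4, show relax (T k) (l k) z = z by rw [relax, hz k, ← add_smul]; simp,
    sub_sub_sub_cancel_right, norm_sub_rev (x k) (x (k + 1))] at h
  -- The two ends of the interval for `l k` bound numerator and denominator separately.
  have h3 : e * (1 + r - e)⁻¹ ≤ (1 + r - l k) / l k := by
    rw [← div_eq_mul_inv]
    gcongr
    · linarith
    · linarith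
  linarith [mul_le_mul_of_nonneg_right h3 (sq_nonneg ‖x (k + 1) - x k‖)]

lemma Iterates.fejerMonotone (hT : ∀ k, AveragedWith r (T k)) (he : 0 < e)
    (hl : ∀ k, l k ∈ Set.Icc e (1 + r - e)) (hx : Iterates T l x) :
    FejerMonotone x (commonFix T) := by
  intro z hz k
  have h := hx.sq_le hT he hl hz k
  have hpos : 0 < 1 + r - e := by linarith [(hl k).1, (hl k).2]
  have : 0 ≤ e * (1 + r - e)⁻¹ * ‖x (k + 1) - x k‖ ^ 2 := by positivity
  exact le_of_sq_le_sq (by linarith) (norm_nonneg _)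

lemma Iterates.tendsto_step (hT : ∀ k, AveragedWith r (T k)) (he : 0 < e)
    (hl : ∀ k, l k ∈ Set.Icc e (1 + r - e)) (hx : Iterates T l x) (hC : (commonFix T).Nonempty) :
    Tendsto (fun k => ‖x (k + 1) - x k‖) atTop (𝓝 0) := by
  obtain ⟨z, hz⟩ := hC
  have hpos : 0 < 1 + r - e := by linarith [(hl 0).1, (hl 0).2]
  obtain ⟨a, ha⟩ := (hx.fejerMonotone hT he hl).exists_tendsto hz
  have h1 : Tendsto (fun k => (e * (1 + r - e)⁻¹)⁻¹ * (‖x k - z‖ ^ 2 - ‖x (k + 1) - z‖ ^ 2))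
      atTop (𝓝 0) := by
    simpa using ((ha.pow 2).sub ((ha.comp (tendsto_add_atTop_nat 1)).pow 2)).const_mul
      (e * (1 + r - e)⁻¹)⁻¹
  have h2 : Tendsto (fun k => ‖x (k + 1) - x k‖ ^ 2) atTop (𝓝 0) := by
    refine squeeze_zero (fun k => by positivity) (fun k => ?_) h1
    rw [le_inv_mul_iff₀ (by positivity)]
    linarith [hx.sq_le hT he hl hz k]
  simpa using h2.sqrt

lemma Iterates.tendsto_residual (hT : ∀ k, AveragedWith r (T k)) (hr : 0 ≤ r) (he : 0 < e)
    (hl : ∀ k, l k ∈ Set.Icc e (1 + r - e)) (hrec : Recurrent T) (hx : Iterates T l x)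
    (hC : (commonFix T).Nonempty) (j : ℕ) :
    Tendsto (fun k => ‖T j (x k) - x k‖) atTop (𝓝 0) := by
  have hd := hx.tendsto_step hT he hl hC
  have hres : ∀ k, ‖T k (x k) - x k‖ ≤ e⁻¹ * ‖x (k + 1) - x k‖ := fun k => by
    have hpos := he.trans_le (hl k).1
    rw [hx k, add_sub_cancel_left, norm_smul, Real.norm_eq_abs, abs_of_pos hpos,
      le_inv_mul_iff₀ he]
    exact mul_le_mul_of_nonneg_right (hl k).1 (norm_nonneg _)
  obtain ⟨M, hM⟩ := hrec j
  have hsum : ∀ n k, ‖x (k + n) - x k‖ ≤ ∑ i ∈ Finset.range n, ‖x (k + i + 1) - x (k + i)‖ := by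
    intro n k
    induction n with
    | zero => simp
    | succ n ih =>
      rw [Finset.sum_range_succ]
      have := norm_sub_le_norm_sub_add_norm_sub (x (k + (n + 1))) (x (k + n)) (x k)
      rw [← add_assoc] at this ⊢
      linarith
  -- Pass from `x k` to the next visit `x (k + i)` of `T j`, with `i ≤ M`: the displacement enters
  -- twice (once through `T j`), and the residual at the visit costs `e⁻¹` times a single step.
  have hlim : Tendsto (fun k => (2 + e⁻¹) *
      ∑ i ∈ Finset.range (M + 1), ‖x (k + i + 1) - x (k + i)‖) atTop (𝓝 0) := by
    have h := (tendsto_finsetSum (Finset.range (M + 1))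
      fun i _ => hd.comp (tendsto_add_atTop_nat i)).const_mul (2 + e⁻¹)
    simpa using h
  refine squeeze_zero (fun k => norm_nonneg _) (fun k => ?_) hlim
  obtain ⟨n, h1, h2, h3⟩ := hM k
  obtain ⟨i, rfl⟩ := Nat.exists_eq_add_of_le h1
  have hi : i < M + 1 := by omega
  have a1 : ‖x (k + i) - x k‖ ≤ ∑ i ∈ Finset.range (M + 1), ‖x (k + i + 1) - x (k + i)‖ :=
    (hsum i k).trans (Finset.sum_le_sum_of_subset_of_nonneg
      (Finset.range_subset_range.2 hi.le) fun _ _ _ => norm_nonneg _)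
  have a2 : ‖x (k + i + 1) - x (k + i)‖
      ≤ ∑ i ∈ Finset.range (M + 1), ‖x (k + i + 1) - x (k + i)‖ :=
    Finset.single_le_sum (f := fun i => ‖x (k + i + 1) - x (k + i)‖)
      (fun _ _ => norm_nonneg _) (Finset.mem_range.2 hi)
  have a3 := (hT j).nonexpansive hr (x k) (x (k + i))
  have a4 := hres (k + i)
  rw [h3] at a4
  have a5 := norm_sub_le_norm_sub_add_norm_sub (T j (x k)) (T j (x (k + i))) (x k)
  have a6 := norm_sub_le_norm_sub_add_norm_sub (T j (x (k + i))) (x (k + i)) (x k)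
  rw [norm_sub_rev (x k)] at a3
  have a7 := mul_le_mul_of_nonneg_left a2 (inv_pos.2 he).le
  linarith

lemma Iterates.convergesWeaklyIn [CompleteSpace H] (hT : ∀ k, AveragedWith r (T k)) (hr : 0 ≤ r)
    (he : 0 < e) (hl : ∀ k, l k ∈ Set.Icc e (1 + r - e)) (hrec : Recurrent T)
    (hx : Iterates T l x) (hC : (commonFix T).Nonempty) : ConvergesWeaklyIn x (commonFix T) := by
  have hF := hx.fejerMonotone hT he hl
  refine hF.convergesWeaklyIn hC fun F p hFle hp j => ?_
  obtain ⟨z, hz⟩ := hC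
  refine fixed_of_weak_limit ((hT j).nonexpansive hr) (R := ‖x 0 - z‖ + ‖z‖ + ‖p‖)
    (fun k => ?_) hp ((hx.tendsto_residual hT hr he hl hrec ⟨z, hz⟩ j).mono_left hFle)
  exact (norm_sub_le _ _).trans (by gcongr; exact hF.norm_le hz k)

lemma AveragedWith.continuous {E : Type*} [NormedAddCommGroup E] {T : E → E}
    (hT : AveragedWith r T) (hr : 0 ≤ r) :
    Continuous T := by
  refine LipschitzWith.continuous (K := 1) (LipschitzWith.of_dist_le_mul fun x y => ?_)
  simpa [dist_eq_norm] using hT.nonexpansive hr x y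

lemma Iterates.convergesStronglyIn [CompleteSpace H] (hT : ∀ k, AveragedWith r (T k)) (hr : 0 ≤ r)
    (he : 0 < e) (hl : ∀ k, l k ∈ Set.Icc e (1 + r - e)) (hrec : Recurrent T)
    (hx : Iterates T l x) (hC : (commonFix T).Nonempty)
    (hsh : ∀ j, ApproximatelyShrinking (T j))
    (hreg : BoundedlyRegular fun j => Function.fixedPoints (T j)) :
    ConvergesStronglyIn x (commonFix T) := by
  have hF := hx.fejerMonotone hT he hl
  refine hF.convergesStronglyIn hC (isClosed_commonFix fun k => (hT k).continuous hr) ?_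
  obtain ⟨z, hz⟩ := hC
  have hbd : Bornology.IsBounded (Set.range x) :=
    isBounded_iff_forall_norm_le.2 ⟨_, by rintro _ ⟨k, rfl⟩; exact hF.norm_le hz k⟩
  have h := hreg x hbd fun j =>
    (hsh j).2 x hbd (hx.tendsto_residual hT hr he hl hrec ⟨z, hz⟩ j)
  rwa [show (⋂ j, Function.fixedPoints (T j)) = commonFix T by
    ext y; simp [commonFix, Function.IsFixedPt]] at h

end Iteration

/-! ### Perturbed iterations -/

section Perturbed

/-- A three-epsilon argument, used for `y` itself in the strong case and for the scalars `⟪u, y k⟫`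
in the weak case. -/
lemma tendsto_of_shadowing {X : Type*} [PseudoMetricSpace X] {f : ℕ → X} {g : ℕ → ℕ → X}
    {a : ℕ → X} {b : X} {s : ℕ → ℝ} (hg : ∀ n, Tendsto (g n) atTop (𝓝 (a n)))
    (hs : ∀ n k, dist (g n k) (f (n + k)) ≤ s n) (hs0 : Tendsto s atTop (𝓝 0))
    (ha : Tendsto a atTop (𝓝 b)) : Tendsto f atTop (𝓝 b) := by
  refine Metric.tendsto_atTop.2 fun e he => ?_
  have he3 : 0 < e / 3 := by positivity
  obtain ⟨n, h1, h2⟩ := ((hs0.eventually (gt_mem_nhds he3)).and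
    (ha.eventually (Metric.ball_mem_nhds b he3))).exists
  obtain ⟨N, hN⟩ := Metric.tendsto_atTop.1 (hg n) _ he3
  refine ⟨n + N, fun k hk => ?_⟩
  obtain ⟨i, rfl⟩ := Nat.exists_eq_add_of_le (show n ≤ k by omega)
  have h3 := hN i (by omega)
  have h4 := hs n i
  rw [dist_comm] at h4
  have h5 := dist_triangle4 (f (n + i)) (g n i) (a n) b
  linarith

variable {H : Type*} [NormedAddCommGroup H] [InnerProductSpace ℝ H]

/-- If the orbits `g n` shadow the tails of `f` with errors tending to zero and converge weakly in
a closed set `C`, then their weak limits converge strongly in `C`. -/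
lemma exists_tendsto_of_shadowing [CompleteSpace H] {f : ℕ → H} {g : ℕ → ℕ → H} {a : ℕ → H}
    {s : ℕ → ℝ} {C : Set H} (hC : IsClosed C) (haC : ∀ n, a n ∈ C)
    (hg : ∀ n, WeakTendsto (g n) (a n)) (hs : ∀ n k, ‖g n k - f (n + k)‖ ≤ s n)
    (hs0 : Tendsto s atTop (𝓝 0)) : ∃ p ∈ C, Tendsto a atTop (𝓝 p) := by
  have hle : ∀ n i, ‖a n - a (n + i)‖ ≤ s n + s (n + i) := by
    intro n i
    set u := a n - a (n + i) with hu
    -- Test the two weak limits against their own difference `u`. Delaying the first orbit by `i`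
    -- makes both shadow `f (n + i + k)`.
    have h1 := (((hg n).inner u).comp (tendsto_add_atTop_nat i)).sub ((hg (n + i)).inner u)
    rw [← inner_sub_right, ← hu, real_inner_self_eq_norm_sq] at h1
    have h2 : ‖u‖ ^ 2 ≤ ‖u‖ * (s n + s (n + i)) := by
      refine le_of_tendsto' h1 fun k => ?_
      have h3 := hs n (k + i)
      have h4 := hs (n + i) k
      rw [show n + (k + i) = n + i + k by omega] at h3
      rw [norm_sub_rev] at h4
      simp only [Function.comp_apply]
      rw [← inner_sub_right]
      refine (real_inner_le_norm _ _).trans ?_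
      gcongr
      exact (norm_sub_le_norm_sub_add_norm_sub _ _ _).trans (add_le_add h3 h4)
    have hs1 : 0 ≤ s n := (norm_nonneg _).trans (hs n 0)
    have hs2 : 0 ≤ s (n + i) := (norm_nonneg _).trans (hs (n + i) 0)
    rcases (norm_nonneg u).eq_or_lt with h0 | h0
    · rw [← h0]; positivity
    · exact le_of_mul_le_mul_left (by rwa [← sq]) h0
  have hcau : CauchySeq a := by
    refine Metric.cauchySeq_iff'.2 fun e he => ?_
    obtain ⟨N, hN⟩ := eventually_atTop.1 (hs0.eventually (gt_mem_nhds (half_pos he)))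
    refine ⟨N, fun n hn => ?_⟩
    obtain ⟨i, rfl⟩ := Nat.exists_eq_add_of_le hn
    rw [dist_comm, dist_eq_norm]
    linarith [hle N i, hN N le_rfl, hN (N + i) hn]
  obtain ⟨p, hp⟩ := cauchySeq_tendsto_of_complete hcau
  exact ⟨p, hC.mem_of_tendsto hp (Eventually.of_forall haC), hp⟩

/-- The orbit of the shifted algorithm `S (n + ·)` started at `x`. -/
def orbit (S : ℕ → H → H) (n : ℕ) (x : H) : ℕ → H
  | 0 => x
  | k + 1 => S (n + k) (orbit S n x k)

lemma generatedBy_orbit {X : Type*} (S : ℕ → X → X) (n : ℕ) (x : X) :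
    GeneratedBy (fun k => S (n + k)) (orbit S n x) := fun _ => rfl

/-- Nonexpansive maps never amplify earlier errors, so perturbations merely add up, to at most a
tail of the convergent series `∑ b k * R`. -/
lemma PerturbedBy.exists_shadowing {S : ℕ → H → H} (hS : ∀ k x y, ‖S k x - S k y‖ ≤ ‖x - y‖)
    {b : ℕ → ℝ} {v y : ℕ → H} (hy : PerturbedBy S b v y) :
    ∃ s : ℕ → ℝ, Tendsto s atTop (𝓝 0) ∧
      ∀ n k, ‖orbit S n (y n) k - y (n + k)‖ ≤ s n := by
  obtain ⟨hb, hsum, hv, hyk⟩ := hy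
  obtain ⟨R, hR⟩ := isBounded_iff_forall_norm_le.1 hv
  have hR' : ∀ k, ‖v k‖ ≤ R := fun k => hR _ ⟨k, rfl⟩
  have hR0 : 0 ≤ R := (norm_nonneg _).trans (hR' 0)
  refine ⟨fun n => ∑' k, b (k + n) * R, tendsto_sum_nat_add fun k => b k * R, fun n k => ?_⟩
  have hpart : ‖orbit S n (y n) k - y (n + k)‖ ≤ ∑ i ∈ Finset.range k, b (i + n) * R := by
    induction k with
    | zero => simp [orbit]
    | succ k ih =>
      rw [Finset.sum_range_succ, orbit, ← add_assoc, hyk]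
      refine (hS _ _ _).trans ?_
      rw [← sub_sub]
      refine (norm_sub_le _ _).trans (add_le_add ih ?_)
      rw [norm_smul, Real.norm_eq_abs, abs_of_pos (hb _), add_comm n k]
      exact mul_le_mul_of_nonneg_left (hR' _) (hb _).le
  have hs' : Summable fun k => b (k + n) * R := ((summable_nat_add_iff n).2 hsum).mul_right R
  exact hpart.trans (hs'.sum_le_tsum _ fun i _ => mul_nonneg (hb _).le hR0)

variable [CompleteSpace H] {S : ℕ → H → H} {C : Set H}

lemma PerturbedBy.convergesWeaklyIn (hS : ∀ k x y, ‖S k x - S k y‖ ≤ ‖x - y‖) (hC : IsClosed C)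
    (hconv : ∀ (n : ℕ) (z : ℕ → H), GeneratedBy (fun k => S (n + k)) z → ConvergesWeaklyIn z C)
    {b : ℕ → ℝ} {v y : ℕ → H} (hy : PerturbedBy S b v y) : ConvergesWeaklyIn y C := by
  obtain ⟨s, hs0, hs⟩ := hy.exists_shadowing hS
  choose a haC ha using fun n => hconv n _ (generatedBy_orbit S n (y n))
  obtain ⟨p, hpC, hp⟩ := exists_tendsto_of_shadowing hC haC ha hs hs0
  refine ⟨p, hpC, weakTendsto_iff_inner.2 fun u => ?_⟩
  refine tendsto_of_shadowing (fun n => (ha n).inner u) (s := fun n => ‖u‖ * s n)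
    (fun n k => ?_) (by simpa using hs0.const_mul ‖u‖) (tendsto_const_nhds.inner hp)
  rw [Real.dist_eq, ← inner_sub_right]
  exact (abs_real_inner_le_norm _ _).trans (by gcongr; exact hs n k)

lemma PerturbedBy.convergesStronglyIn (hS : ∀ k x y, ‖S k x - S k y‖ ≤ ‖x - y‖) (hC : IsClosed C)
    (hconv : ∀ (n : ℕ) (z : ℕ → H), GeneratedBy (fun k => S (n + k)) z → ConvergesStronglyIn z C)
    {b : ℕ → ℝ} {v y : ℕ → H} (hy : PerturbedBy S b v y) : ConvergesStronglyIn y C := by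
  obtain ⟨s, hs0, hs⟩ := hy.exists_shadowing hS
  choose a haC ha using fun n => hconv n _ (generatedBy_orbit S n (y n))
  obtain ⟨p, hpC, hp⟩ := exists_tendsto_of_shadowing hC haC
    (fun n => ((toWeakSpaceCLM ℝ H).continuous.tendsto (a n)).comp (ha n)) hs hs0
  exact ⟨p, hpC, tendsto_of_shadowing ha (fun n k => by rw [dist_eq_norm]; exact hs n k) hs0 hp⟩

end Perturbed

end GDSA

theorem theorem4p5 {H : Type*} [NormedAddCommGroup H] [InnerProductSpace ℝ H] [CompleteSpace H]
    -- the input operators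
    (m : ℕ) (hm : 0 < m) (U : Fin m → H → H) (α : Fin m → ℝ)
    (hα : ∀ i, α i ∈ Set.Ioc (0 : ℝ) 2)
    (hU : ∀ i, GDSA.RelaxedFirmlyNonexpansive (α i) (U i))
    -- the string lengths, the sets of strings and the weights
    (q : ℕ → ℕ) (hq : ∀ k, 0 < q k) (hqb : BddAbove (Set.range q))
    (Ω : (k : ℕ) → Finset (Fin (q k) → Fin m)) (hΩ : ∀ k, (Ω k).Nonempty)
    (ω : (k : ℕ) → (Fin (q k) → Fin m) → ℝ)
    (hω : ∀ k, ∀ t ∈ Ω k, ω k t ∈ Set.Ioc (0 : ℝ) 1)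
    (hω1 : ∀ k, ∑ t ∈ Ω k, ω k t = 1)
    -- the string-averaging operators
    (T : ℕ → H → H) (hT : ∀ k, T k = GDSA.stringAvg U (Ω k) (ω k))
    (hC : (GDSA.target T).Nonempty) (hadm : GDSA.LimsupAdmissible T)
    -- the relaxation parameters and the iterates
    (ε : ℝ) (hε : 0 < ε) (l : ℕ → ℝ)
    (hl : ∀ k, l k ∈ Set.Icc ε (1 + GDSA.rho α q - ε))
    (x : ℕ → H) (hx : GDSA.Iterates T l x) :
    -- (i)
    GDSA.ConvergesWeaklyIn x (GDSA.target T) ∧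
    -- (ii)
    (GDSA.FejerMonotone x (GDSA.target T) ∧
      (∀ z ∈ GDSA.target T, ∀ k : ℕ,
        ‖x (k + 1) - z‖ ^ 2 ≤
          ‖x k - z‖ ^ 2 - ε * (1 + GDSA.rho α q - ε)⁻¹ * ‖x (k + 1) - x k‖ ^ 2) ∧
      Tendsto (fun k => ‖x (k + 1) - x k‖) atTop (𝓝 0)) ∧
    -- (iii)
    ((∀ S ∈ GDSA.opLimsup T, GDSA.ApproximatelyShrinking S) →
      GDSA.BoundedlyRegular (fun S : GDSA.opLimsup T => Function.fixedPoints S.1) →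
      GDSA.ConvergesStronglyIn x (GDSA.target T)) ∧
    -- (iv), weak resilience
    GDSA.WeaklyResilient (fun k => GDSA.relax (T k) (l k)) (GDSA.target T) ∧
    -- (iv), strong resilience if the convergence of the iteration is strong
    ((∀ (n : ℕ) (z : ℕ → H),
        GDSA.Iterates (fun k => T (n + k)) (fun k => l (n + k)) z →
        GDSA.ConvergesStronglyIn z (GDSA.target T)) →
      GDSA.StronglyResilient (fun k => GDSA.relax (T k) (l k)) (GDSA.target T)) ∧
    -- (iv), strong resilience under the assumptions of (iii)
    ((∀ S ∈ GDSA.opLimsup T, GDSA.ApproximatelyShrinking S) →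
      GDSA.BoundedlyRegular (fun S : GDSA.opLimsup T => Function.fixedPoints S.1) →
      GDSA.StronglyResilient (fun k => GDSA.relax (T k) (l k)) (GDSA.target T)) := by
  have hr := GDSA.rho_nonneg hα q
  have hav : ∀ k, GDSA.AveragedWith (GDSA.rho α q) (T k) := fun k => by
    rw [hT k]
    exact GDSA.averagedWith_stringAvg hα hU hqb (hq k) (fun t ht => (hω k t ht).1.le) (hω1 k)
  have hrec := hadm.recurrent
  have hne : ∀ k x y, ‖GDSA.relax (T k) (l k) x - GDSA.relax (T k) (l k) y‖ ≤ ‖x - y‖ := fun k =>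
    ((hav k).relax (hε.trans_le (hl k).1)).nonexpansive
      (div_nonneg (by linarith [(hl k).2]) (by linarith [(hl k).1]))
  have hclosed := GDSA.isClosed_commonFix fun k => (hav k).continuous hr
  have htar := GDSA.target_eq_commonFix hadm
  have hshift := hrec.commonFix_shift
  have hI : GDSA.opLimsup T = Set.range T := by
    refine Set.Subset.antisymm (fun S hS => ?_) (Set.range_subset_iff.2 hadm.1)
    obtain ⟨M, -, hM⟩ := hadm.2 S hS
    obtain ⟨n, -, h⟩ := hM 0
    exact ⟨n, h.symm⟩
  rw [htar] at hC ⊢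
  have hstrong : (∀ S ∈ GDSA.opLimsup T, GDSA.ApproximatelyShrinking S) →
      GDSA.BoundedlyRegular (fun S : GDSA.opLimsup T => Function.fixedPoints S.1) →
      ∀ (n : ℕ) (z : ℕ → H), GDSA.Iterates (fun k => T (n + k)) (fun k => l (n + k)) z →
        GDSA.ConvergesStronglyIn z (GDSA.commonFix T) := by
    intro hsh hreg n z hz
    -- By recurrence, the tail from `n` still runs through all of `opLimsup T`, so the two families
    -- contain the same sets.
    have hreg' : GDSA.BoundedlyRegular fun j => Function.fixedPoints (T (n + j)) := by
      intro w hw hd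
      have h := hreg w hw fun S => by
        obtain ⟨j, hj⟩ := hI.subset S.2
        obtain ⟨M, hM⟩ := hrec j
        obtain ⟨i, hi, -, hij⟩ := hM n
        change Tendsto (fun k => Metric.infDist (w k) (Function.fixedPoints S.1)) atTop (𝓝 0)
        rw [← hj, ← hij, ← Nat.add_sub_cancel' hi]
        exact hd _
      rwa [show (⋂ S : GDSA.opLimsup T, Function.fixedPoints S.1)
        = ⋂ j, Function.fixedPoints (T (n + j)) by
          rw [← Set.biInter_eq_iInter (GDSA.opLimsup T) fun S _ => Function.fixedPoints S]
          rw [show (⋂ S ∈ GDSA.opLimsup T, Function.fixedPoints S) = GDSA.target T from rfl,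
            htar, ← hshift n]
          ext z
          simp [GDSA.commonFix, Function.IsFixedPt]] at h
    rw [← hshift n] at hC ⊢
    exact hz.convergesStronglyIn (fun k => hav (n + k)) hr hε (fun k => hl (n + k))
      (hrec.shift n) hC (fun j => hsh _ (hadm.1 _)) hreg'
  refine ⟨hx.convergesWeaklyIn hav hr hε hl hrec hC,
    ⟨hx.fejerMonotone hav hε hl, fun z hz => hx.sq_le hav hε hl hz,
      hx.tendsto_step hav hε hl hC⟩,
    fun hsh hreg => hstrong hsh hreg 0 x (by simpa using hx),
    fun _ b v y hy => hy.convergesWeaklyIn hne hclosed fun n z hz => ?_,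
    fun hst _ b v y hy => hy.convergesStronglyIn hne hclosed fun n z hz =>
      hst n z (GDSA.iterates_iff_generatedBy.2 hz),
    fun hsh hreg _ b v y hy => hy.convergesStronglyIn hne hclosed fun n z hz =>
      hstrong hsh hreg n z (GDSA.iterates_iff_generatedBy.2 hz)⟩
  rw [← hshift n] at hC ⊢
  exact (GDSA.iterates_iff_generatedBy.2 hz).convergesWeaklyIn (fun k => hav (n + k)) hr hε
    (fun k => hl (n + k)) (hrec.shift n) hC
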